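/- A stream is a finite sequence $I_1,\dots,I_n$ of closed unit-length intervals $[a,a+1]$, $a\in\mathbb{R}$. A set of intervals is independent if its members are pairwise disjoint (as sets of points, so intervals that share an endpoint are not disjoint), and $OPT$ denotes a largest independent set of intervals of the stream. The Unit Interval Selection problem asks for an independent set of intervals of the stream of largest possible size. A deterministic one-pass streaming algorithm reads the intervals one at a time and keeps a memory of words, where each word holds either one interval that has already arrived or one letter of a fixed finite alphabet; the new memory is a function of the old memory and the arriving interval, and at the end of the stream a set of intervals held in memory is reported. The algorithm knows neither $n$ nor $|OPT|$ in advance. Theorem. There are a deterministic one-pass streaming algorithm for Unit Interval Selection and a constant $C$ such that: 1. on every stream, in any order, the algorithm reports an independent set of intervals of the stream; 2. on every stream, in any order, the algorithm never uses more than $C\cdot|OPT|$ words of memory at any time, i.e. it uses $O(|OPT|)$ words of space; 3. on every instance $I_1,\dots,I_n$, presented in uniformly random order, the set reported has expected size at least $0.7401\cdot|OPT|$, where the expectation is taken over the order of the stream. -/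

import Mathlib

namespace UnitIntervalSelection

/-- A closed interval of length one on the real line, given by its left endpoint. -/
@[ext]
structure UnitInterval where
  left : ℝ

/-- The set of points `[left, left + 1]` of a unit interval. -/
def UnitInterval.toSet (I : UnitInterval) : Set ℝ := Set.Icc I.left (I.left + 1)

/-- A set of unit intervals is independent if its members are pairwise disjoint as sets. -/
def IsIndependent (F : Finset UnitInterval) : Prop :=
  ∀ I ∈ F, ∀ J ∈ F, I ≠ J → I.toSet ∩ J.toSet = ∅

open Classical in
/-- `|OPT|`: the size of a largest independent set of intervals occurring in the stream. -/
noncomputable def optSize (S : List UnitInterval) : ℕ :=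
  (S.toFinset.powerset.filter IsIndependent).sup Finset.card

/-- One word of memory: it holds either one interval, or one symbol of a finite alphabet
with `k` letters. -/
inductive MemWord (k : ℕ) where
  | interval (I : UnitInterval) : MemWord k
  | symbol (s : Fin k) : MemWord k

/-- A deterministic one-pass streaming algorithm for the selection of unit intervals.

Between two arrivals it keeps a finite list of words. The alphabet, whose size is fixed once and
for all, serves for all bookkeeping. When an interval arrives, the memory is replaced by a new one
that depends only on the old memory and on that interval. The only intervals that can ever be
held in memory are intervals that have arrived: the new memory may hold those of the old memory
and the one that has just arrived. (So no information about the stream can be packed into the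
digits of a fabricated real number.) The solution is selected from the intervals in memory.

The algorithm is told neither the length of the stream nor the size of an optimal solution. -/
structure StreamingAlgorithm where
  /-- size of the alphabet -/
  alphabetSize : ℕ
  /-- memory before the first arrival -/
  init : List (MemWord alphabetSize)
  /-- new memory, from the old memory and the arriving interval -/
  update : List (MemWord alphabetSize) → UnitInterval → List (MemWord alphabetSize)
  /-- the solution reported from the memory at the end of the stream -/
  output : List (MemWord alphabetSize) → Finset UnitInterval
  /-- no interval is in memory at the start -/
  not_mem_init : ∀ I, MemWord.interval I ∉ init
  /-- intervals enter the memory only by arriving -/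
  mem_update : ∀ M I J, MemWord.interval J ∈ update M I → MemWord.interval J ∈ M ∨ J = I
  /-- only intervals in memory are reported -/
  mem_output : ∀ M, ∀ I ∈ output M, MemWord.interval I ∈ M

namespace StreamingAlgorithm

/-- The memory after the algorithm has read the stream `S` once, from first to last. -/
def run (A : StreamingAlgorithm) (S : List UnitInterval) : List (MemWord A.alphabetSize) :=
  S.foldl A.update A.init

/-- The number of words in memory after the stream `S` has been read. -/
def words (A : StreamingAlgorithm) (S : List UnitInterval) : ℕ := (A.run S).length

/-- The set of intervals reported on the stream `S`. -/
def result (A : StreamingAlgorithm) (S : List UnitInterval) : Finset UnitInterval :=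
  A.output (A.run S)

/-- On every stream (in any order), the reported set consists of intervals of the stream and is
independent. -/
def Solves (A : StreamingAlgorithm) : Prop :=
  ∀ S : List UnitInterval, (∀ I ∈ A.result S, I ∈ S) ∧ IsIndependent (A.result S)

/-- On every stream (in any order), the memory never holds more than `C * |OPT|` words, at any
time of the pass, where `OPT` is optimal for the whole stream. -/
def UsesAtMost (A : StreamingAlgorithm) (C : ℕ) : Prop :=
  ∀ S P : List UnitInterval, P <+: S → A.words P ≤ C * optSize S

/-- The expected number of intervals reported when the `n` intervals of the instance `x` arrive
in uniformly random order. -/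
noncomputable def expectedSize (A : StreamingAlgorithm) {n : ℕ} (x : Fin n → UnitInterval) : ℝ :=
  (∑ σ : Equiv.Perm (Fin n), ((A.result (List.ofFn (fun i => x (σ i)))).card : ℝ)) /
    (n.factorial : ℝ)

end StreamingAlgorithm

end UnitIntervalSelection

namespace UnitIntervalSelection

open scoped Classical

/-! ### Independent sets of unit intervals -/

/-! Assign each interval to the cell `[z, z+1)` containing its left endpoint. In each nonempty cell
the memory keeps, as cores, the leftmost start and the `K` rightmost ones. With each core it keeps
the closest disjoint interval on either side among later arrivals. The report is a maximum
independent set of everything held. Cells of one parity supply pairwise disjoint intervals, so at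
most `2 * |OPT|` cells are nonempty, and the space is linear (`algorithm_usesAtMost`).

An interval retained with respect to the whole stream is a core ever since its first arrival
(`Retained.anti`), so its stored neighbours are at least as close as any disjoint interval arriving
later (`exists_anchor_next`, `exists_anchor_prev`).

For the expectation, sort an optimal solution `p 0, ..., p (m-1)` from left to right, with its two
ends replaced by the extreme intervals of the instance, which are retained. If `p j` is not retained
(it is heavy), at least `K` retained intervals lie to its right in its cell. Except with probability
at most `2 / (K + 1)`, one of them arrives before both `p (j-1)` and `p (j+2)`. That separator and
its two stored neighbours are three disjoint intervals, all starting more than 1 after `p (j-2)` and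
no later than `p (j+2)`: a gain of 3 over four steps (`potential_heavy_four`). Thus long heavy runs
yield the ratio 3/4.

Between consecutive retained members at distance `4 * d + r`, `1 ≤ r ≤ 4`, the remaining `r` steps
add 1, 3/2, 9/4 or 3 on average, never less than `3 * r / 4` (`sum_potential_run`). The fractions
come from the relative order of a retained end and its heavy neighbour. The potential credits 3 for
each missing separator. Removing these credits costs at most `6 * m / (K + 1)`, which is small for
large `K`. -/

theorem UnitInterval.inter_eq_empty_of_lt {I J : UnitInterval} (h : I.left + 1 < J.left) :
    I.toSet ∩ J.toSet = ∅ := by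
  ext y
  simp only [UnitInterval.toSet, Set.mem_inter_iff, Set.mem_Icc, Set.mem_empty_iff_false,
    iff_false]
  rintro ⟨⟨_, h1⟩, h2, _⟩
  linarith

theorem UnitInterval.left_add_one_lt_of_inter_eq_empty {I J : UnitInterval}
    (h : I.toSet ∩ J.toSet = ∅) (hle : I.left ≤ J.left) : I.left + 1 < J.left := by
  by_contra hc
  have : J.left ∈ I.toSet ∩ J.toSet := ⟨⟨hle, not_lt.mp hc⟩, le_rfl, by linarith⟩
  rw [h] at this
  exact this

theorem IsIndependent.insert {F : Finset UnitInterval} (hF : IsIndependent F) {y : UnitInterval}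
    (hy : ∀ I ∈ F, I.left + 1 < y.left) : IsIndependent (insert y F) := by
  intro I hI J hJ hne
  rw [Finset.mem_insert] at hI hJ
  rcases hI with rfl | hI <;> rcases hJ with rfl | hJ
  · exact absurd rfl hne
  · rw [Set.inter_comm]
    exact UnitInterval.inter_eq_empty_of_lt (hy J hJ)
  · exact UnitInterval.inter_eq_empty_of_lt (hy I hI)
  · exact hF I hI J hJ hne

theorem card_le_optSize {S : List UnitInterval} {F : Finset UnitInterval}
    (hS : ∀ I ∈ F, I ∈ S) (hF : IsIndependent F) : F.card ≤ optSize S := by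
  unfold optSize
  refine Finset.le_sup (f := Finset.card) ?_
  rw [Finset.mem_filter, Finset.mem_powerset]
  exact ⟨fun I hI => List.mem_toFinset.mpr (hS I hI), hF⟩

theorem exists_card_eq_optSize (S : List UnitInterval) :
    ∃ F : Finset UnitInterval, (∀ I ∈ F, I ∈ S) ∧ IsIndependent F ∧ F.card = optSize S := by
  have hne : (S.toFinset.powerset.filter IsIndependent).Nonempty := by
    refine ⟨∅, ?_⟩
    rw [Finset.mem_filter, Finset.mem_powerset]
    exact ⟨Finset.empty_subset _, fun I hI => absurd hI (Finset.notMem_empty I)⟩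
  obtain ⟨F, hF, h⟩ := Finset.exists_mem_eq_sup _ hne Finset.card
  rw [Finset.mem_filter, Finset.mem_powerset] at hF
  exact ⟨F, fun I hI => List.mem_toFinset.mp (hF.1 hI), hF.2, h.symm⟩

theorem optSize_mono {P S : List UnitInterval} (h : ∀ I ∈ P, I ∈ S) : optSize P ≤ optSize S := by
  obtain ⟨F, hP, hF, hc⟩ := exists_card_eq_optSize P
  exact hc ▸ card_le_optSize (fun I hI => h I (hP I hI)) hF

/-- The largest size of an independent subset of `M` whose members start at `b` or before. -/
noncomputable def bestUpTo (M : Finset UnitInterval) (b : ℝ) : ℕ :=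
  ((M.filter (fun I => I.left ≤ b)).powerset.filter IsIndependent).sup Finset.card

theorem card_le_bestUpTo {M F : Finset UnitInterval} {b : ℝ} (hM : F ⊆ M)
    (hb : ∀ I ∈ F, I.left ≤ b) (hF : IsIndependent F) : F.card ≤ bestUpTo M b := by
  refine Finset.le_sup (f := Finset.card) ?_
  rw [Finset.mem_filter, Finset.mem_powerset]
  exact ⟨fun I hI => Finset.mem_filter.mpr ⟨hM hI, hb I hI⟩, hF⟩

theorem exists_card_eq_bestUpTo (M : Finset UnitInterval) (b : ℝ) :
    ∃ F ⊆ M, (∀ I ∈ F, I.left ≤ b) ∧ IsIndependent F ∧ F.card = bestUpTo M b := by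
  have hne : ((M.filter (fun I => I.left ≤ b)).powerset.filter IsIndependent).Nonempty := by
    refine ⟨∅, ?_⟩
    rw [Finset.mem_filter, Finset.mem_powerset]
    exact ⟨Finset.empty_subset _, fun I hI => absurd hI (Finset.notMem_empty I)⟩
  obtain ⟨F, hF, h⟩ := Finset.exists_mem_eq_sup _ hne Finset.card
  rw [Finset.mem_filter, Finset.mem_powerset] at hF
  exact ⟨F, fun I hI => (Finset.mem_filter.mp (hF.1 hI)).1,
    fun I hI => (Finset.mem_filter.mp (hF.1 hI)).2, hF.2, h.symm⟩

theorem bestUpTo_mono (M : Finset UnitInterval) {b c : ℝ} (h : b ≤ c) :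
    bestUpTo M b ≤ bestUpTo M c := by
  obtain ⟨F, hM, hb, hF, hc⟩ := exists_card_eq_bestUpTo M b
  exact hc ▸ card_le_bestUpTo hM (fun I hI => (hb I hI).trans h) hF

/-- The basic gain: any held interval lying wholly beyond the prefix extends its best solution.
Every increment of the potential is a chain of such extensions. -/
theorem bestUpTo_add_one_le {M : Finset UnitInterval} {b : ℝ} {y : UnitInterval} (hy : y ∈ M)
    (hb : b + 1 < y.left) : bestUpTo M b + 1 ≤ bestUpTo M y.left := by
  obtain ⟨F, hM, hF, hi, hc⟩ := exists_card_eq_bestUpTo M b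
  have hlt : ∀ I ∈ F, I.left + 1 < y.left := fun I hI => by linarith [hF I hI]
  have hn : y ∉ F := fun h => by linarith [hlt y h]
  rw [← hc, ← Finset.card_insert_of_notMem hn]
  refine card_le_bestUpTo (Finset.insert_subset hy hM) ?_ (hi.insert hlt)
  intro I hI
  rcases Finset.mem_insert.mp hI with rfl | hI
  · exact le_rfl
  · linarith [hlt I hI]

theorem one_le_bestUpTo {M : Finset UnitInterval} {y : UnitInterval} (hy : y ∈ M) :
    1 ≤ bestUpTo M y.left :=
  (Nat.le_add_left 1 _).trans (bestUpTo_add_one_le (b := y.left - 2) hy (by linarith))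

/-! ### The algorithm -/

/-- An interval in memory together with the closest disjoint intervals on its two sides among
those that arrived after it (a copy of any interval that is not disjoint stands for none). -/
structure Anchor where
  core : UnitInterval
  next : UnitInterval
  prev : UnitInterval

/-- Update of an anchor when the interval `I` arrives. -/
noncomputable def Anchor.observe (t : Anchor) (I : UnitInterval) : Anchor where
  core := t.core
  next := if t.core.left + 1 < I.left ∧
    (t.next.left ≤ t.core.left + 1 ∨ I.left < t.next.left) then I else t.next
  prev := if I.left + 1 < t.core.left ∧
    (t.core.left ≤ t.prev.left + 1 ∨ t.prev.left < I.left) then I else t.prev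

/-- Within the intervals of `U` starting in the same unit cell, `J` is leftmost or one of the
`K` rightmost. -/
def Retained (K : ℕ) (U : Finset UnitInterval) (J : UnitInterval) : Prop :=
  (U.filter (fun L => ⌊L.left⌋ = ⌊J.left⌋ ∧ J.left < L.left)).card < K ∨
    ∀ L ∈ U, ⌊L.left⌋ = ⌊J.left⌋ → J.left ≤ L.left

/-- Fewer competitors only help. Hence retention with respect to the full stream, a property
independent of the order, guarantees survival against every intermediate memory. -/
theorem Retained.anti {K : ℕ} {U V : Finset UnitInterval} {J : UnitInterval}
    (h : Retained K V J) (hUV : U ⊆ V) : Retained K U J := by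
  rcases h with h | h
  · exact Or.inl ((Finset.card_le_card (Finset.filter_subset_filter _ hUV)).trans_lt h)
  · exact Or.inr fun L hL => h L (hUV hL)

noncomputable def cores (T : List Anchor) : Finset UnitInterval := (T.map Anchor.core).toFinset

theorem mem_cores {T : List Anchor} {J : UnitInterval} :
    J ∈ cores T ↔ ∃ t ∈ T, t.core = J := by
  simp [cores]

/-- A repeated core is not restarted, so its neighbours count from its first arrival. A new anchor
uses `I` itself as the placeholder for both missing neighbours. -/
noncomputable def addAnchor (T : List Anchor) (I : UnitInterval) : List Anchor :=
  if I ∈ cores T then T.map (fun t => t.observe I)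
  else ⟨I, I, I⟩ :: T.map (fun t => t.observe I)

noncomputable def step (K : ℕ) (T : List Anchor) (I : UnitInterval) : List Anchor :=
  (addAnchor T I).filter (fun t => Retained K (cores (addAnchor T I)) t.core)

noncomputable def anchors (K : ℕ) (S : List UnitInterval) : List Anchor := S.foldl (step K) []

/-! ### Encoding anchors as memory words -/

def encode (T : List Anchor) : List (MemWord 0) :=
  T.flatMap fun t => [.interval t.core, .interval t.next, .interval t.prev]

/-- The fallback case only makes the update total on lists that are not encodings; such memories
never arise in a run. -/
def decode : List (MemWord 0) → List Anchor
  | .interval a :: .interval b :: .interval c :: M => ⟨a, b, c⟩ :: decode M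
  | _ => []

theorem decode_encode (T : List Anchor) : decode (encode T) = T := by
  induction T with
  | nil => rfl
  | cons t T ih =>
    change t :: decode (encode T) = _
    rw [ih]

theorem length_encode (T : List Anchor) : (encode T).length = 3 * T.length := by
  induction T with
  | nil => rfl
  | cons t T ih =>
    change (encode T).length + 3 = _
    rw [ih, List.length_cons]
    ring

theorem interval_mem_encode {T : List Anchor} {J : UnitInterval} :
    MemWord.interval J ∈ encode T ↔ ∃ t ∈ T, J = t.core ∨ J = t.next ∨ J = t.prev := by
  simp [encode]

theorem interval_mem_of_mem_decode {M : List (MemWord 0)} {t : Anchor} (ht : t ∈ decode M) :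
    MemWord.interval t.core ∈ M ∧ MemWord.interval t.next ∈ M ∧ MemWord.interval t.prev ∈ M := by
  induction M using decode.induct with
  | case1 a b c M ih =>
    rw [decode, List.mem_cons] at ht
    rcases ht with rfl | ht
    · simp
    · obtain ⟨h1, h2, h3⟩ := ih ht
      simp [h1, h2, h3]
  | case2 M h =>
    rw [decode] at ht
    · simp at ht
    · exact h

theorem mem_addAnchor {T : List Anchor} {I : UnitInterval} {t : Anchor}
    (ht : t ∈ addAnchor T I) : t = ⟨I, I, I⟩ ∨ ∃ s ∈ T, t = s.observe I := by
  unfold addAnchor at ht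
  split_ifs at ht
  · obtain ⟨s, hs, rfl⟩ := List.mem_map.mp ht
    exact Or.inr ⟨s, hs, rfl⟩
  · rcases List.mem_cons.mp ht with rfl | ht
    · exact Or.inl rfl
    · obtain ⟨s, hs, rfl⟩ := List.mem_map.mp ht
      exact Or.inr ⟨s, hs, rfl⟩

theorem observe_mem_addAnchor {T : List Anchor} {t : Anchor} (ht : t ∈ T) (I : UnitInterval) :
    t.observe I ∈ addAnchor T I := by
  unfold addAnchor
  split_ifs
  · exact List.mem_map.mpr ⟨t, ht, rfl⟩
  · exact List.mem_cons_of_mem _ (List.mem_map.mpr ⟨t, ht, rfl⟩)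

theorem mem_cores_addAnchor {T : List Anchor} {I J : UnitInterval} :
    J ∈ cores (addAnchor T I) ↔ J = I ∨ J ∈ cores T := by
  constructor
  · intro h
    obtain ⟨t, ht, rfl⟩ := mem_cores.mp h
    rcases mem_addAnchor ht with rfl | ⟨s, hs, rfl⟩
    · exact Or.inl rfl
    · exact Or.inr (mem_cores.mpr ⟨s, hs, rfl⟩)
  · have hT : J ∈ cores T → J ∈ cores (addAnchor T I) := fun h => by
      obtain ⟨t, ht, rfl⟩ := mem_cores.mp h
      exact mem_cores.mpr ⟨_, observe_mem_addAnchor ht I, rfl⟩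
    rintro (rfl | h)
    · by_cases h : J ∈ cores T
      · exact hT h
      · refine mem_cores.mpr ⟨⟨J, J, J⟩, ?_, rfl⟩
        rw [addAnchor, if_neg h]
        exact List.mem_cons_self
    · exact hT h

theorem mem_step {K : ℕ} {T : List Anchor} {I : UnitInterval} {t : Anchor} :
    t ∈ step K T I ↔ t ∈ addAnchor T I ∧ Retained K (cores (addAnchor T I)) t.core := by
  simp [step]

/-- The intervals held in memory. -/
noncomputable def heldIntervals {k : ℕ} (M : List (MemWord k)) : Finset UnitInterval :=
  (M.filterMap fun w => match w with
    | .interval I => some I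
    | .symbol _ => none).toFinset

theorem mem_heldIntervals {k : ℕ} {M : List (MemWord k)} {I : UnitInterval} :
    I ∈ heldIntervals M ↔ MemWord.interval I ∈ M := by
  simp only [heldIntervals, List.mem_toFinset, List.mem_filterMap]
  constructor
  · rintro ⟨w, hw, h⟩
    cases w with
    | interval J => simpa [Option.some_inj.mp h] using hw
    | symbol s => simp at h
  · intro h
    exact ⟨_, h, rfl⟩

theorem exists_max_independent (M : Finset UnitInterval) :
    ∃ F ⊆ M, IsIndependent F ∧ ∀ b, bestUpTo M b ≤ F.card := by
  have hne : (M.powerset.filter IsIndependent).Nonempty := by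
    refine ⟨∅, ?_⟩
    rw [Finset.mem_filter, Finset.mem_powerset]
    exact ⟨Finset.empty_subset _, fun I hI => absurd hI (Finset.notMem_empty I)⟩
  obtain ⟨F, hF, h⟩ := Finset.exists_max_image _ Finset.card hne
  rw [Finset.mem_filter, Finset.mem_powerset] at hF
  refine ⟨F, hF.1, hF.2, fun b => ?_⟩
  obtain ⟨E, hM, _, hE, hc⟩ := exists_card_eq_bestUpTo M b
  exact hc ▸ h E (Finset.mem_filter.mpr ⟨Finset.mem_powerset.mpr hM, hE⟩)

/-- No letters are needed, so the alphabet is empty. The report ranges over all intervals held, the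
neighbours as well as the cores. -/
noncomputable def algorithm (K : ℕ) : StreamingAlgorithm where
  alphabetSize := 0
  init := []
  update M I := encode (step K (decode M) I)
  output M := (exists_max_independent (heldIntervals M)).choose
  not_mem_init I := List.not_mem_nil
  mem_update M I J h := by
    obtain ⟨t, ht, hJ⟩ := interval_mem_encode.mp h
    rcases mem_addAnchor (mem_step.mp ht).1 with rfl | ⟨s, hs, rfl⟩
    · simp at hJ
      exact Or.inr hJ
    · obtain ⟨h1, h2, h3⟩ := interval_mem_of_mem_decode hs
      rcases hJ with rfl | rfl | rfl
      · exact Or.inl h1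
      · simp only [Anchor.observe]
        split_ifs
        · exact Or.inr rfl
        · exact Or.inl h2
      · simp only [Anchor.observe]
        split_ifs
        · exact Or.inr rfl
        · exact Or.inl h3
  mem_output M I h :=
    mem_heldIntervals.mp ((exists_max_independent (heldIntervals M)).choose_spec.1 h)

theorem StreamingAlgorithm.mem_of_interval_mem_run (A : StreamingAlgorithm)
    {S : List UnitInterval} {I : UnitInterval} (h : MemWord.interval I ∈ A.run S) : I ∈ S := by
  induction S using List.reverseRecOn with
  | nil => exact absurd h (A.not_mem_init I)
  | append_singleton S J ih =>
    rw [StreamingAlgorithm.run, List.foldl_append] at h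
    rcases A.mem_update _ _ _ h with h | rfl
    · exact List.mem_append_left _ (ih h)
    · simp

theorem algorithm_solves (K : ℕ) : (algorithm K).Solves := by
  intro S
  refine ⟨fun I hI => (algorithm K).mem_of_interval_mem_run ((algorithm K).mem_output _ I hI), ?_⟩
  exact (exists_max_independent (heldIntervals ((algorithm K).run S))).choose_spec.2.1

theorem anchors_append_singleton (K : ℕ) (S : List UnitInterval) (I : UnitInterval) :
    anchors K (S ++ [I]) = step K (anchors K S) I := by
  rw [anchors, List.foldl_append]
  rfl

theorem run_algorithm (K : ℕ) (S : List UnitInterval) :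
    (algorithm K).run S = encode (anchors K S) := by
  have h : S.foldl (fun M I => encode (step K (decode M) I)) [] = encode (anchors K S) := by
    induction S using List.reverseRecOn with
    | nil => rfl
    | append_singleton S I ih =>
      rw [List.foldl_append, ih, anchors_append_singleton]
      change encode (step K (decode (encode (anchors K S))) I) = _
      rw [decode_encode]
  exact h

/-- The intervals in memory after the stream `S`. -/
noncomputable def finalIntervals (K : ℕ) (S : List UnitInterval) : Finset UnitInterval :=
  heldIntervals (encode (anchors K S))

theorem bestUpTo_le_card_result (K : ℕ) (S : List UnitInterval) (b : ℝ) :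
    bestUpTo (finalIntervals K S) b ≤ ((algorithm K).result S).card := by
  have h : bestUpTo (heldIntervals ((algorithm K).run S)) b ≤ ((algorithm K).result S).card :=
    (exists_max_independent (heldIntervals ((algorithm K).run S))).choose_spec.2.2 b
  rwa [run_algorithm] at h

theorem mem_finalIntervals {K : ℕ} {S : List UnitInterval} {t : Anchor}
    (ht : t ∈ anchors K S) :
    t.core ∈ finalIntervals K S ∧ t.next ∈ finalIntervals K S ∧ t.prev ∈ finalIntervals K S := by
  simp only [finalIntervals, mem_heldIntervals]
  exact ⟨interval_mem_encode.mpr ⟨t, ht, Or.inl rfl⟩,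
    interval_mem_encode.mpr ⟨t, ht, Or.inr (Or.inl rfl)⟩,
    interval_mem_encode.mpr ⟨t, ht, Or.inr (Or.inr rfl)⟩⟩

theorem mem_of_mem_cores_anchors {K : ℕ} {S : List UnitInterval} {J : UnitInterval}
    (h : J ∈ cores (anchors K S)) : J ∈ S := by
  obtain ⟨t, ht, rfl⟩ := mem_cores.mp h
  refine (algorithm K).mem_of_interval_mem_run ?_
  rw [run_algorithm]
  exact interval_mem_encode.mpr ⟨t, ht, Or.inl rfl⟩

/-! ### Space -/

/-- With `K + 2` members, the second leftmost is not the leftmost and has at least `K` members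
strictly to its right, so it cannot be retained. -/
theorem card_le_of_retained {K : ℕ} {D : Finset UnitInterval}
    (hcell : ∀ I ∈ D, ∀ J ∈ D, ⌊I.left⌋ = ⌊J.left⌋) (h : ∀ J ∈ D, Retained K D J) :
    D.card ≤ K + 1 := by
  by_contra hc
  obtain ⟨a, ha, hamin⟩ := Finset.exists_min_image D UnitInterval.left
    (Finset.card_pos.mp (by omega))
  have hcard := Finset.card_erase_of_mem ha
  obtain ⟨b, hb, hbmin⟩ := Finset.exists_min_image (D.erase a) UnitInterval.left
    (Finset.card_pos.mp (by omega))
  have hbD := Finset.mem_of_mem_erase hb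
  have hba : b ≠ a := (Finset.mem_erase.mp hb).1
  have hcard' := Finset.card_erase_of_mem hb
  rcases h b hbD with h | h
  · have hle : (D.erase a).erase b ⊆
        D.filter (fun L => ⌊L.left⌋ = ⌊b.left⌋ ∧ b.left < L.left) := ?_
    · have := Finset.card_le_card hle
      omega
    intro L hL
    have hL' := Finset.mem_of_mem_erase hL
    have hLD := Finset.mem_of_mem_erase hL'
    refine Finset.mem_filter.mpr ⟨hLD, hcell _ hLD _ hbD, (hbmin L hL').lt_of_ne fun he => ?_⟩
    exact (Finset.mem_erase.mp hL).1 (UnitInterval.ext he.symm)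
  · exact hba (UnitInterval.ext (le_antisymm (h a ha (hcell _ ha _ hbD)) (hamin b hbD)))

theorem nodup_cores_anchors (K : ℕ) (S : List UnitInterval) :
    ((anchors K S).map Anchor.core).Nodup := by
  induction S using List.reverseRecOn with
  | nil => simp [anchors]
  | append_singleton S I ih =>
    rw [anchors_append_singleton, step]
    refine List.Nodup.sublist (List.Sublist.map _ List.filter_sublist) ?_
    have hmap : ((anchors K S).map (fun t => t.observe I)).map Anchor.core =
        (anchors K S).map Anchor.core := by
      rw [List.map_map]
      rfl
    unfold addAnchor
    split_ifs with h
    · rw [hmap]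
      exact ih
    · rw [List.map_cons, hmap, List.nodup_cons]
      exact ⟨fun hm => h (by simpa [cores] using hm), ih⟩

theorem retained_cores_anchors {K : ℕ} {S : List UnitInterval} {J : UnitInterval}
    (hJ : J ∈ cores (anchors K S)) : Retained K (cores (anchors K S)) J := by
  induction S using List.reverseRecOn with
  | nil => simp [anchors, cores] at hJ
  | append_singleton S I ih =>
    rw [anchors_append_singleton] at *
    obtain ⟨t, ht, rfl⟩ := mem_cores.mp hJ
    refine (mem_step.mp ht).2.anti fun L hL => ?_
    obtain ⟨s, hs, rfl⟩ := mem_cores.mp hL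
    exact mem_cores.mpr ⟨s, (mem_step.mp hs).1, rfl⟩

/-- One representative per cell suffices: an interval starting before `z + 1` ends before `z + 2`,
where the next allowed cell begins at the earliest. This is applied to the even and the odd cells
separately. -/
theorem card_le_optSize_of_floor {S : List UnitInterval} {Z : Finset ℤ}
    (hZ : ∀ z ∈ Z, ∃ I ∈ S, ⌊I.left⌋ = z) (hgap : ∀ z ∈ Z, ∀ w ∈ Z, z < w → z + 2 ≤ w) :
    Z.card ≤ optSize S := by
  have : Nonempty UnitInterval := ⟨⟨0⟩⟩
  choose! f hf using hZ
  have hinj : Set.InjOn f Z := fun z hz w hw h => by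
    rw [← (hf z hz).2, h, (hf w hw).2]
  rw [← Finset.card_image_of_injOn hinj]
  have hlt : ∀ z ∈ Z, ∀ w ∈ Z, z < w → (f z).left + 1 < (f w).left := fun z hz w hw h => by
    have h1 := Int.lt_floor_add_one (f z).left
    have h2 := Int.floor_le (f w).left
    rw [(hf z hz).2] at h1
    rw [(hf w hw).2] at h2
    have h3 : ((z + 2 : ℤ) : ℝ) ≤ w := by exact_mod_cast hgap z hz w hw h
    push_cast at h3
    linarith
  refine card_le_optSize (fun I hI => ?_) fun I hI J hJ hne => ?_
  · obtain ⟨z, hz, rfl⟩ := Finset.mem_image.mp hI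
    exact (hf z hz).1
  · obtain ⟨z, hz, rfl⟩ := Finset.mem_image.mp hI
    obtain ⟨w, hw, rfl⟩ := Finset.mem_image.mp hJ
    rcases lt_trichotomy z w with h | rfl | h
    · exact UnitInterval.inter_eq_empty_of_lt (hlt z hz w hw h)
    · exact absurd rfl hne
    · rw [Set.inter_comm]
      exact UnitInterval.inter_eq_empty_of_lt (hlt w hw z hz h)

theorem card_floor_le (S : List UnitInterval) :
    (S.toFinset.image fun I => ⌊I.left⌋).card ≤ 2 * optSize S := by
  set Z := S.toFinset.image fun I => ⌊I.left⌋
  have hZ : ∀ z ∈ Z, ∃ I ∈ S, ⌊I.left⌋ = z := fun z hz => by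
    obtain ⟨I, hI, rfl⟩ := Finset.mem_image.mp hz
    exact ⟨I, List.mem_toFinset.mp hI, rfl⟩
  have h1 : (Z.filter Even).card ≤ optSize S := by
    refine card_le_optSize_of_floor (fun z hz => hZ z (Finset.mem_filter.mp hz).1)
      fun z hz w hw h => ?_
    have h1 := (Finset.mem_filter.mp hz).2
    have h2 := (Finset.mem_filter.mp hw).2
    rw [Int.even_iff] at h1 h2
    omega
  have h2 : (Z.filter (fun z => ¬ Even z)).card ≤ optSize S := by
    refine card_le_optSize_of_floor (fun z hz => hZ z (Finset.mem_filter.mp hz).1)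
      fun z hz w hw h => ?_
    have h1 := (Finset.mem_filter.mp hz).2
    have h2 := (Finset.mem_filter.mp hw).2
    rw [Int.even_iff] at h1 h2
    omega
  have h3 := Z.card_filter_add_card_filter_not Even
  omega

theorem algorithm_usesAtMost (K : ℕ) : (algorithm K).UsesAtMost (6 * (K + 1)) := by
  intro S P hP
  refine le_trans ?_ (Nat.mul_le_mul_left _ (optSize_mono fun I hI => hP.subset hI))
  have hlen : (anchors K P).length = (cores (anchors K P)).card := by
    rw [cores, List.toFinset_card_of_nodup (nodup_cores_anchors K P), List.length_map]
  have hwords : (algorithm K).words P = 3 * (cores (anchors K P)).card := by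
    rw [← hlen, ← length_encode, StreamingAlgorithm.words, run_algorithm]
    rfl
  rw [hwords]
  have hfib := Finset.card_le_mul_card_image_of_maps_to (s := cores (anchors K P))
    (t := P.toFinset.image fun I => ⌊I.left⌋) (f := fun I => ⌊I.left⌋)
    (fun J hJ => Finset.mem_image_of_mem _
      (List.mem_toFinset.mpr (mem_of_mem_cores_anchors hJ))) (K + 1) fun z _ => by
      refine card_le_of_retained (fun I hI J hJ => ?_) fun J hJ => ?_
      · exact (Finset.mem_filter.mp hI).2.trans (Finset.mem_filter.mp hJ).2.symm
      · exact (retained_cores_anchors (Finset.mem_filter.mp hJ).1).anti (Finset.filter_subset _ _)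
  have := card_floor_le P
  nlinarith

/-! ### What is in memory at the end -/

theorem cores_addAnchor_subset (K : ℕ) (S : List UnitInterval) (I : UnitInterval) :
    cores (addAnchor (anchors K S) I) ⊆ (S ++ [I]).toFinset := fun L hL => by
  rcases mem_cores_addAnchor.mp hL with rfl | hL
  · simp
  · have := mem_of_mem_cores_anchors hL
    simp [this]

theorem observe_mem_anchors {K : ℕ} {S : List UnitInterval} {I : UnitInterval} {t : Anchor}
    (ht : t ∈ anchors K S) (h : Retained K (S ++ [I]).toFinset t.core) :
    t.observe I ∈ anchors K (S ++ [I]) := by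
  rw [anchors_append_singleton, mem_step]
  exact ⟨observe_mem_addAnchor ht I, h.anti (cores_addAnchor_subset K S I)⟩

theorem retained_of_append {K : ℕ} {S : List UnitInterval} {I J : UnitInterval}
    (h : Retained K (S ++ [I]).toFinset J) : Retained K S.toFinset J :=
  h.anti fun L hL => by
    have := List.mem_toFinset.mp hL
    simp [this]

/-- The algorithm compares an interval only with the cores in memory, a subset of the stream, so
retention with respect to the stream implies that it passes every test. -/
theorem exists_anchor {K : ℕ} {S : List UnitInterval} {J : UnitInterval} (hJ : J ∈ S)
    (h : Retained K S.toFinset J) : ∃ t ∈ anchors K S, t.core = J := by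
  induction S using List.reverseRecOn with
  | nil => simp at hJ
  | append_singleton S I ih =>
    have hcore : J ∈ cores (addAnchor (anchors K S) I) := by
      rw [mem_cores_addAnchor]
      rcases List.mem_append.mp hJ with hJ | hJ
      · obtain ⟨t, ht, rfl⟩ := ih hJ (retained_of_append h)
        exact Or.inr (mem_cores.mpr ⟨t, ht, rfl⟩)
      · exact Or.inl (List.mem_singleton.mp hJ)
    obtain ⟨t, ht, rfl⟩ := mem_cores.mp hcore
    refine ⟨t, ?_, rfl⟩
    rw [anchors_append_singleton, mem_step]
    exact ⟨ht, h.anti (cores_addAnchor_subset K S I)⟩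

/-- `J` occurs in the list before some occurrence of `X`. -/
def Precedes (S : List UnitInterval) (J X : UnitInterval) : Prop :=
  ∃ S₁ S₂, S = S₁ ++ S₂ ∧ J ∈ S₁ ∧ X ∈ S₂

theorem precedes_append_singleton {S : List UnitInterval} {I J X : UnitInterval}
    (h : Precedes (S ++ [I]) J X) : Precedes S J X ∨ (J ∈ S ∧ X = I) := by
  obtain ⟨S₁, S₂, hS, hJ, hX⟩ := h
  induction S₂ using List.reverseRecOn with
  | nil => simp at hX
  | append_singleton S₂ Y _ =>
    rw [← List.append_assoc] at hS
    obtain ⟨rfl, hY⟩ := List.append_inj' hS rfl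
    obtain rfl : I = Y := by simpa using hY
    rcases List.mem_append.mp hX with hX | hX
    · exact Or.inl ⟨S₁, S₂, rfl, hJ, hX⟩
    · exact Or.inr ⟨List.mem_append_left _ hJ, List.mem_singleton.mp hX⟩

theorem exists_anchor_next {K : ℕ} {S : List UnitInterval} {J X : UnitInterval}
    (h : Retained K S.toFinset J) (hp : Precedes S J X) (hX : J.left + 1 < X.left) :
    ∃ t ∈ anchors K S, t.core = J ∧ J.left + 1 < t.next.left ∧ t.next.left ≤ X.left := by
  induction S using List.reverseRecOn with
  | nil =>
    obtain ⟨S₁, S₂, hS, hJ, -⟩ := hp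
    simp [(List.append_eq_nil_iff.mp hS.symm).1] at hJ
  | append_singleton S I ih =>
    rcases precedes_append_singleton hp with hp | ⟨hJ, rfl⟩
    · obtain ⟨t, ht, rfl, h1, h2⟩ := ih (retained_of_append h) hp
      refine ⟨_, observe_mem_anchors ht h, rfl, ?_⟩
      simp only [Anchor.observe]
      split_ifs with hc
      · exact ⟨hc.1, by rcases hc.2 with hc | hc <;> linarith⟩
      · exact ⟨h1, h2⟩
    · obtain ⟨t, ht, rfl⟩ := exists_anchor hJ (retained_of_append h)
      refine ⟨_, observe_mem_anchors ht h, rfl, ?_⟩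
      simp only [Anchor.observe]
      split_ifs with hc
      · exact ⟨hc.1, le_rfl⟩
      · simp only [hX, true_and, not_or, not_le, not_lt] at hc
        exact hc

theorem exists_anchor_prev {K : ℕ} {S : List UnitInterval} {J X : UnitInterval}
    (h : Retained K S.toFinset J) (hp : Precedes S J X) (hX : X.left + 1 < J.left) :
    ∃ t ∈ anchors K S, t.core = J ∧ t.prev.left + 1 < J.left ∧ X.left ≤ t.prev.left := by
  induction S using List.reverseRecOn with
  | nil =>
    obtain ⟨S₁, S₂, hS, hJ, -⟩ := hp
    simp [(List.append_eq_nil_iff.mp hS.symm).1] at hJ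
  | append_singleton S I ih =>
    rcases precedes_append_singleton hp with hp | ⟨hJ, rfl⟩
    · obtain ⟨t, ht, rfl, h1, h2⟩ := ih (retained_of_append h) hp
      refine ⟨_, observe_mem_anchors ht h, rfl, ?_⟩
      simp only [Anchor.observe]
      split_ifs with hc
      · exact ⟨hc.1, by rcases hc.2 with hc | hc <;> linarith⟩
      · exact ⟨h1, h2⟩
    · obtain ⟨t, ht, rfl⟩ := exists_anchor hJ (retained_of_append h)
      refine ⟨_, observe_mem_anchors ht h, rfl, ?_⟩
      simp only [Anchor.observe]
      split_ifs with hc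
      · exact ⟨hc.1, le_rfl⟩
      · simp only [hX, true_and, not_or, not_le, not_lt] at hc
        exact hc

/-! ### Counting orders of arrival -/

section Counting

variable {n : ℕ}

/-- The number of orders of arrival with the property `P`. -/
noncomputable def orderCount (P : Equiv.Perm (Fin n) → Prop) : ℕ := (Finset.univ.filter P).card

theorem orderCount_mul_left (P : Equiv.Perm (Fin n) → Prop) (π : Equiv.Perm (Fin n)) :
    orderCount (fun σ => P (π * σ)) = orderCount P := by
  refine Finset.card_equiv (Equiv.mulLeft π) fun σ => ?_
  simp

theorem orderCount_true : orderCount (fun _ : Equiv.Perm (Fin n) => True) = n.factorial := by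
  simp [orderCount, Fintype.card_perm]

theorem orderCount_and_add_orderCount_and_not (P R : Equiv.Perm (Fin n) → Prop) :
    orderCount (fun σ => P σ ∧ R σ) + orderCount (fun σ => P σ ∧ ¬ R σ) = orderCount P := by
  have h := (Finset.univ.filter P).card_filter_add_card_filter_not R
  rw [Finset.filter_filter, Finset.filter_filter] at h
  unfold orderCount
  convert h

theorem orderCount_eq_sum (P : Equiv.Perm (Fin n) → Prop) :
    orderCount P = ∑ σ, if P σ then 1 else 0 := by
  rw [orderCount, Finset.card_filter]

theorem symm_swap_mul_apply (a b c : Fin n) (σ : Equiv.Perm (Fin n)) :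
    (Equiv.swap a b * σ).symm c = σ.symm (Equiv.swap a b c) := by
  change (Equiv.swap a b * σ)⁻¹ c = σ⁻¹ (Equiv.swap a b c)
  rw [mul_inv_rev, Equiv.swap_inv, Equiv.Perm.mul_apply]

theorem not_symm_lt_iff {a b : Fin n} (hab : a ≠ b) (σ : Equiv.Perm (Fin n)) :
    ¬ σ.symm a < σ.symm b ↔ σ.symm b < σ.symm a := by
  rw [not_lt]
  exact ⟨fun h => h.lt_of_ne fun he => hab (σ.symm.injective he).symm, le_of_lt⟩

/-- Here `σ.symm a` is the arrival time of `a`. Exchanging `a` and `b` is a bijection of the orders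
that preserves `P` and reverses their comparison. -/
theorem two_mul_orderCount_and_lt {a b : Fin n} (hab : a ≠ b) (P : Equiv.Perm (Fin n) → Prop)
    (hP : ∀ σ, P (Equiv.swap a b * σ) ↔ P σ) :
    2 * orderCount (fun σ => P σ ∧ σ.symm a < σ.symm b) = orderCount P := by
  have h1 := orderCount_and_add_orderCount_and_not P (fun σ => σ.symm a < σ.symm b)
  have h2 := orderCount_mul_left (fun σ => P σ ∧ σ.symm a < σ.symm b) (Equiv.swap a b)
  simp only [hP, symm_swap_mul_apply, Equiv.swap_apply_left, Equiv.swap_apply_right] at h2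
  simp only [not_symm_lt_iff hab] at h1
  omega

theorem two_mul_orderCount_lt {a b : Fin n} (hab : a ≠ b) :
    2 * orderCount (fun σ : Equiv.Perm (Fin n) => σ.symm a < σ.symm b) = n.factorial := by
  have h := two_mul_orderCount_and_lt hab (fun _ => True) fun _ => Iff.rfl
  simpa only [true_and, orderCount_true] using h

theorem four_mul_orderCount_lt_and_lt {a b c d : Fin n} (hab : a ≠ b) (hcd : c ≠ d)
    (hac : a ≠ c) (had : a ≠ d) (hbc : b ≠ c) (hbd : b ≠ d) :
    4 * orderCount (fun σ : Equiv.Perm (Fin n) =>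
      σ.symm a < σ.symm b ∧ σ.symm c < σ.symm d) = n.factorial := by
  have h := two_mul_orderCount_and_lt hcd (fun σ => σ.symm a < σ.symm b) fun σ => by
    simp only [symm_swap_mul_apply, Equiv.swap_apply_of_ne_of_ne hac had,
      Equiv.swap_apply_of_ne_of_ne hbc hbd]
  have h' := two_mul_orderCount_lt hab
  omega

/-- The events that a given element of `insert z Q` comes first are disjoint, and transpositions
show them equally likely; so each has probability at most `1 / (Q.card + 1)`. -/
theorem card_add_one_mul_orderCount_first_le {Q : Finset (Fin n)} {z : Fin n} (hz : z ∉ Q) :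
    (Q.card + 1) * orderCount (fun σ => ∀ q ∈ Q, σ.symm z < σ.symm q) ≤ n.factorial := by
  obtain ⟨E, hEdef⟩ : ∃ E : Fin n → Equiv.Perm (Fin n) → Prop,
      ∀ t σ, E t σ ↔ ∀ q ∈ insert z Q, q ≠ t → σ.symm t < σ.symm q := ⟨_, fun _ _ => Iff.rfl⟩
  have hE : ∀ t ∈ insert z Q, (Finset.univ.filter (E t)).card =
      orderCount (fun σ => ∀ q ∈ Q, σ.symm z < σ.symm q) := by
    intro t ht
    rw [← orderCount_mul_left _ (Equiv.swap z t)]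
    change orderCount (E t) = _
    congr 1
    ext σ
    simp only [hEdef, symm_swap_mul_apply, Equiv.swap_apply_left]
    constructor
    · intro h q hq
      have hqz : q ≠ z := fun he => hz (he ▸ hq)
      by_cases hqt : q = t
      · subst hqt
        rw [Equiv.swap_apply_right]
        exact h z (Finset.mem_insert_self _ _) hqz.symm
      · rw [Equiv.swap_apply_of_ne_of_ne hqz hqt]
        exact h q (Finset.mem_insert_of_mem hq) hqt
    · intro h q hq hqt
      rcases Finset.mem_insert.mp hq with rfl | hq
      · have := h t (Finset.mem_of_mem_insert_of_ne ht hqt.symm)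
        rwa [Equiv.swap_apply_right] at this
      · have hqz : q ≠ z := fun he => hz (he ▸ hq)
        have := h q hq
        rwa [Equiv.swap_apply_of_ne_of_ne hqz hqt] at this
  have hdisj : (↑(insert z Q) : Set (Fin n)).PairwiseDisjoint
      fun t => Finset.univ.filter (E t) := by
    intro s hs t ht hst
    refine Finset.disjoint_left.mpr fun σ h1 h2 => ?_
    have h1' := (hEdef _ _).mp (Finset.mem_filter.mp h1).2 t ht hst.symm
    have h2' := (hEdef _ _).mp (Finset.mem_filter.mp h2).2 s hs hst
    exact lt_asymm h1' h2'
  have h := Finset.card_le_univ ((insert z Q).biUnion fun t => Finset.univ.filter (E t))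
  rw [Finset.card_biUnion hdisj, Finset.sum_congr rfl hE, Finset.sum_const,
    Finset.card_insert_of_notMem hz, Fintype.card_perm, Fintype.card_fin, smul_eq_mul] at h
  exact h

end Counting

/-! ### One order of arrival -/

/-- If fewer than `K` of the intervals to the right in the cell were retained, the rightmost one not
retained would have only retained ones beyond it, fewer than `K`, and would itself be retained. -/
theorem exists_retained_right {K : ℕ} {V : Finset UnitInterval} {J : UnitInterval}
    (h : ¬ Retained K V J) : ∃ Q ⊆ V, K ≤ Q.card ∧
      ∀ L ∈ Q, Retained K V L ∧ ⌊L.left⌋ = ⌊J.left⌋ ∧ J.left < L.left := by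
  set R := V.filter (fun L => ⌊L.left⌋ = ⌊J.left⌋ ∧ J.left < L.left) with hR
  have hK : K ≤ R.card := not_lt.mp fun hc => h (Or.inl hc)
  refine ⟨R.filter (Retained K V), (Finset.filter_subset _ _).trans (Finset.filter_subset _ _),
    ?_, fun L hL => ⟨(Finset.mem_filter.mp hL).2,
      (Finset.mem_filter.mp (Finset.mem_filter.mp hL).1).2⟩⟩
  by_contra hc
  have hne : (R.filter (fun L => ¬ Retained K V L)).Nonempty := by
    rw [← Finset.card_pos]
    have := R.card_filter_add_card_filter_not (Retained K V)
    omega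
  obtain ⟨c, hcm, hmax⟩ := Finset.exists_max_image _ UnitInterval.left hne
  obtain ⟨hcR, hcn⟩ := Finset.mem_filter.mp hcm
  obtain ⟨hcV, hcf, hcJ⟩ := Finset.mem_filter.mp hcR
  refine hcn (Or.inl (lt_of_le_of_lt (Finset.card_le_card fun L hL => ?_) (not_le.mp hc)))
  obtain ⟨hLV, hLf, hLc⟩ := Finset.mem_filter.mp hL
  have hLR : L ∈ R := Finset.mem_filter.mpr ⟨hLV, hLf.trans hcf, hcJ.trans hLc⟩
  refine Finset.mem_filter.mpr ⟨hLR, ?_⟩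
  by_contra hLn
  exact absurd (hmax L (Finset.mem_filter.mpr ⟨hLR, hLn⟩)) (not_le.mpr hLc)

theorem left_lt_add_one_of_floor_eq {I J : UnitInterval} (h : ⌊I.left⌋ = ⌊J.left⌋) :
    I.left < J.left + 1 := by
  have h1 := Int.lt_floor_add_one I.left
  have h2 := Int.floor_le J.left
  rw [h] at h1
  linarith

variable {n : ℕ} (K : ℕ) (x : Fin n → UnitInterval) (m : ℕ) (p : ℕ → Fin n)

theorem toFinset_ofFn_comp (σ : Equiv.Perm (Fin n)) :
    (List.ofFn fun i => x (σ i)).toFinset = Finset.univ.image x := by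
  ext I
  simp only [List.mem_toFinset, List.mem_ofFn, Finset.mem_image, Finset.mem_univ, true_and]
  exact ⟨fun ⟨i, h⟩ => ⟨σ i, h⟩, fun ⟨i, h⟩ => ⟨σ.symm i, by simpa using h⟩⟩

theorem precedes_ofFn {σ : Equiv.Perm (Fin n)} {a b : Fin n} (h : σ.symm a < σ.symm b) :
    Precedes (List.ofFn fun i => x (σ i)) (x a) (x b) := by
  refine ⟨_, _, (List.take_append_drop ((σ.symm a : ℕ) + 1) _).symm, ?_, ?_⟩
  · rw [List.mem_take_iff_getElem]
    exact ⟨σ.symm a, by simp, by simp⟩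
  · rw [List.mem_drop_iff_getElem]
    have h' : (σ.symm a : ℕ) < σ.symm b := h
    have hb := (σ.symm b).isLt
    refine ⟨(σ.symm b : ℕ) - (σ.symm a + 1), by simp; omega, ?_⟩
    have : (σ.symm a : ℕ) + 1 + ((σ.symm b : ℕ) - (σ.symm a + 1)) = σ.symm b := by omega
    simp [this]

/-- The interval `x q` stays in memory, lies in the cell of `x (p j)` to the right of it, and
arrives before `x (p (j - 1))` and `x (p (j + 2))`. -/
def Separates (σ : Equiv.Perm (Fin n)) (j : ℕ) (q : Fin n) : Prop :=
  (Retained K (Finset.univ.image x) (x q) ∧ ⌊(x q).left⌋ = ⌊(x (p j)).left⌋ ∧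
    (x (p j)).left < (x q).left) ∧
    σ.symm q < σ.symm (p (j - 1)) ∧ σ.symm q < σ.symm (p (j + 2))

/-- Indicator of the failure of every separator at `j`. -/
noncomputable def unseparated (σ : Equiv.Perm (Fin n)) (j : ℕ) : ℕ :=
  if ¬ Retained K (Finset.univ.image x) (x (p j)) ∧ 1 ≤ j ∧ j + 2 < m ∧
    ¬ ∃ q, Separates K x p σ j q then 1 else 0

/-- The best solution in memory up to `x (p i)`, compensated for the missing separators. -/
noncomputable def potential (σ : Equiv.Perm (Fin n)) (i : ℕ) : ℕ :=
  bestUpTo (finalIntervals K (List.ofFn fun j => x (σ j))) (x (p i)).left +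
    3 * ∑ j ∈ Finset.range (i + 1), unseparated K x m p σ j

/-! ### Increments of the potential for a fixed order -/

section Steps

variable {K x m p} {σ : Equiv.Perm (Fin n)}

theorem potential_add_le {i k c : ℕ} (hik : i ≤ k)
    (h : bestUpTo (finalIntervals K (List.ofFn fun j => x (σ j))) (x (p i)).left + c ≤
      bestUpTo (finalIntervals K (List.ofFn fun j => x (σ j))) (x (p k)).left) :
    potential K x m p σ i + c ≤ potential K x m p σ k := by
  have := Finset.sum_le_sum_of_subset (f := unseparated K x m p σ)
    (Finset.range_subset_range.mpr (Nat.add_le_add_right hik 1))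
  unfold potential
  omega

theorem mem_finalIntervals_of_retained {a : Fin n}
    (h : Retained K (Finset.univ.image x) (x a)) :
    x a ∈ finalIntervals K (List.ofFn fun j => x (σ j)) := by
  rw [← toFinset_ofFn_comp x σ] at h
  have hmem : x a ∈ List.ofFn fun j => x (σ j) := by
    rw [← List.mem_toFinset, toFinset_ofFn_comp]
    exact Finset.mem_image_of_mem _ (Finset.mem_univ _)
  obtain ⟨t, ht, hta⟩ := exists_anchor hmem h
  exact hta ▸ (mem_finalIntervals ht).1

theorem exists_next {a b : Fin n} (h : Retained K (Finset.univ.image x) (x a))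
    (hσ : σ.symm a < σ.symm b) (hab : (x a).left + 1 < (x b).left) :
    ∃ y ∈ finalIntervals K (List.ofFn fun j => x (σ j)),
      (x a).left + 1 < y.left ∧ y.left ≤ (x b).left := by
  rw [← toFinset_ofFn_comp x σ] at h
  obtain ⟨t, ht, -, h1, h2⟩ := exists_anchor_next h (precedes_ofFn x hσ) hab
  exact ⟨_, (mem_finalIntervals ht).2.1, h1, h2⟩

theorem exists_prev {a b : Fin n} (h : Retained K (Finset.univ.image x) (x a))
    (hσ : σ.symm a < σ.symm b) (hab : (x b).left + 1 < (x a).left) :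
    ∃ y ∈ finalIntervals K (List.ofFn fun j => x (σ j)),
      y.left + 1 < (x a).left ∧ (x b).left ≤ y.left := by
  rw [← toFinset_ofFn_comp x σ] at h
  obtain ⟨t, ht, -, h1, h2⟩ := exists_anchor_prev h (precedes_ofFn x hσ) hab
  exact ⟨_, (mem_finalIntervals ht).2.2, h1, h2⟩

theorem left_le_left (hgap : ∀ i, i + 1 < m → (x (p i)).left + 1 < (x (p (i + 1))).left)
    {i k : ℕ} (hik : i ≤ k) (hk : k < m) : (x (p i)).left ≤ (x (p k)).left := by
  induction k, hik using Nat.le_induction with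
  | base => exact le_rfl
  | succ k _ ih => linarith [ih (by omega), hgap k hk]

theorem potential_mono (hgap : ∀ i, i + 1 < m → (x (p i)).left + 1 < (x (p (i + 1))).left)
    {i k : ℕ} (hik : i ≤ k) (hk : k < m) : potential K x m p σ i ≤ potential K x m p σ k :=
  potential_add_le (c := 0) hik (Nat.add_zero _ ▸ bestUpTo_mono _ (left_le_left hgap hik hk))

theorem potential_retained (hgap : ∀ i, i + 1 < m → (x (p i)).left + 1 < (x (p (i + 1))).left)
    {i : ℕ} (hi : i + 1 < m) (h : Retained K (Finset.univ.image x) (x (p (i + 1)))) :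
    potential K x m p σ i + 1 ≤ potential K x m p σ (i + 1) :=
  potential_add_le (Nat.le_succ i)
    (bestUpTo_add_one_le (mem_finalIntervals_of_retained h) (hgap i hi))

theorem potential_retained_left
    (hgap : ∀ i, i + 1 < m → (x (p i)).left + 1 < (x (p (i + 1))).left)
    {i : ℕ} (hi : i + 1 < m) (h : Retained K (Finset.univ.image x) (x (p i)))
    (hσ : σ.symm (p i) < σ.symm (p (i + 1))) :
    potential K x m p σ i + 1 ≤ potential K x m p σ (i + 1) := by
  obtain ⟨y, hy, h1, h2⟩ := exists_next h hσ (hgap i hi)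
  exact potential_add_le (Nat.le_succ i)
    ((bestUpTo_add_one_le hy h1).trans (bestUpTo_mono _ h2))

/-- The left neighbour stored with `p (i+2)` starts no earlier than `p (i+1)`, so it can stand in
for it, and `p (i+2)` itself follows. -/
theorem potential_retained_right
    (hgap : ∀ i, i + 1 < m → (x (p i)).left + 1 < (x (p (i + 1))).left)
    {i : ℕ} (hi : i + 2 < m) (h : Retained K (Finset.univ.image x) (x (p (i + 2))))
    (hσ : σ.symm (p (i + 2)) < σ.symm (p (i + 1))) :
    potential K x m p σ i + 2 ≤ potential K x m p σ (i + 2) := by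
  obtain ⟨y, hy, h1, h2⟩ := exists_prev h hσ (hgap (i + 1) hi)
  refine potential_add_le (by omega) ?_
  have e1 := bestUpTo_add_one_le hy (b := (x (p i)).left) (by linarith [hgap i (by omega)])
  have e2 := bestUpTo_add_one_le (mem_finalIntervals_of_retained (σ := σ) h) h1
  omega

/-- Whatever the order, a retained interval to the right of `p (i+1)` in its cell starts between `p
(i+1)` and `p (i+2)`. -/
theorem potential_heavy_two
    (hgap : ∀ i, i + 1 < m → (x (p i)).left + 1 < (x (p (i + 1))).left) (hK : 0 < K)
    {i : ℕ} (hi : i + 2 < m) (h : ¬ Retained K (Finset.univ.image x) (x (p (i + 1)))) :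
    potential K x m p σ i + 1 ≤ potential K x m p σ (i + 2) := by
  obtain ⟨Q, hQ, hcard, hret⟩ := exists_retained_right h
  obtain ⟨J, hJ⟩ := Finset.card_pos.mp (hK.trans_le hcard)
  obtain ⟨a, -, rfl⟩ := Finset.mem_image.mp (hQ hJ)
  obtain ⟨hr, hf, hlt⟩ := hret _ hJ
  refine potential_add_le (by omega) ((bestUpTo_add_one_le (mem_finalIntervals_of_retained hr)
    (by linarith [hgap i (by omega)])).trans (bestUpTo_mono _ ?_))
  linarith [hgap (i + 1) hi, left_lt_add_one_of_floor_eq hf]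

/-- The two intervals gained are the separator and its stored left neighbour, which starts no
earlier than `p (i+1)`. -/
theorem potential_heavy_three_aux
    (hgap : ∀ i, i + 1 < m → (x (p i)).left + 1 < (x (p (i + 1))).left)
    {i : ℕ} (hi : i + 4 < m) {a : Fin n} (ha : Separates K x p σ (i + 2) a) :
    bestUpTo (finalIntervals K (List.ofFn fun j => x (σ j))) (x (p i)).left + 2 ≤
      bestUpTo (finalIntervals K (List.ofFn fun j => x (σ j))) (x a).left := by
  obtain ⟨⟨hr, hf, hlt⟩, hs1, hs2⟩ := ha
  have g1 := hgap (i + 1) (by omega)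
  obtain ⟨y, hy, h1, h2⟩ := exists_prev (b := p (i + 1)) hr hs1 (by linarith)
  have e1 := bestUpTo_add_one_le hy (b := (x (p i)).left) (by linarith [hgap i (by omega)])
  have e2 := bestUpTo_add_one_le (mem_finalIntervals_of_retained (σ := σ) hr) h1
  omega

/-- Without a separator at `j`, the credit of 3 in the potential pays for the whole step; 3 is the
largest gain a separator is asked to give. -/
theorem potential_unseparated
    (hgap : ∀ i, i + 1 < m → (x (p i)).left + 1 < (x (p (i + 1))).left)
    {i j k : ℕ} (hij : i < j) (hjk : j ≤ k) (hk : k < m) (hj : j + 2 < m)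
    (h : ¬ Retained K (Finset.univ.image x) (x (p j)))
    (hs : ¬ ∃ a, Separates K x p σ j a) :
    potential K x m p σ i + 3 ≤ potential K x m p σ k := by
  have hone : unseparated K x m p σ j = 1 := if_pos ⟨h, by omega, hj, hs⟩
  have hnot : j ∉ Finset.range (i + 1) := by
    rw [Finset.mem_range]
    omega
  have hsum := Finset.sum_le_sum_of_subset (f := unseparated K x m p σ)
    (s := insert j (Finset.range (i + 1))) (t := Finset.range (k + 1)) (by
      intro t ht
      rw [Finset.mem_insert, Finset.mem_range] at ht
      rw [Finset.mem_range]
      omega)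
  rw [Finset.sum_insert hnot, hone] at hsum
  have hbest := bestUpTo_mono (finalIntervals K (List.ofFn fun j => x (σ j)))
    (left_le_left hgap (hij.le.trans hjk) hk)
  unfold potential
  omega

theorem potential_heavy_three
    (hgap : ∀ i, i + 1 < m → (x (p i)).left + 1 < (x (p (i + 1))).left)
    {i : ℕ} (hi : i + 4 < m) (h : ¬ Retained K (Finset.univ.image x) (x (p (i + 2)))) :
    potential K x m p σ i + 2 ≤ potential K x m p σ (i + 3) := by
  by_cases hs : ∃ a, Separates K x p σ (i + 2) a
  · obtain ⟨a, ha⟩ := hs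
    refine potential_add_le (by omega)
      ((potential_heavy_three_aux hgap hi ha).trans (bestUpTo_mono _ ?_))
    linarith [hgap (i + 2) (by omega), left_lt_add_one_of_floor_eq ha.1.2.1]
  · have := potential_unseparated (i := i) (k := i + 3) hgap (by omega) (by omega) (by omega)
      (by omega) h hs
    omega

/-- The separator also stores a right neighbour starting no later than `p (i+4)`: it begins less
than 1 after `p (i+2)`, so it is disjoint from `p (i+4)`. -/
theorem potential_heavy_four
    (hgap : ∀ i, i + 1 < m → (x (p i)).left + 1 < (x (p (i + 1))).left)
    {i : ℕ} (hi : i + 4 < m) (h : ¬ Retained K (Finset.univ.image x) (x (p (i + 2)))) :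
    potential K x m p σ i + 3 ≤ potential K x m p σ (i + 4) := by
  by_cases hs : ∃ a, Separates K x p σ (i + 2) a
  · obtain ⟨a, ha⟩ := hs
    have e := potential_heavy_three_aux hgap hi ha
    obtain ⟨⟨hr, hf, hlt⟩, hs1, hs2⟩ := ha
    have g2 := hgap (i + 2) (by omega)
    have g3 := hgap (i + 3) (by omega)
    obtain ⟨y, hy, h1, h2⟩ := exists_next (b := p (i + 4)) hr hs2
      (by linarith [left_lt_add_one_of_floor_eq hf])
    have e1 := bestUpTo_add_one_le hy h1
    have e2 := bestUpTo_mono (finalIntervals K (List.ofFn fun j => x (σ j))) h2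
    refine potential_add_le (by omega) ?_
    omega
  · exact potential_unseparated hgap (by omega) (by omega) (by omega) (by omega) h hs

theorem potential_heavy_run
    (hgap : ∀ i, i + 1 < m → (x (p i)).left + 1 < (x (p (i + 1))).left) {i : ℕ} (d : ℕ)
    (hi : i + 4 * d < m)
    (h : ∀ j, i < j → j < i + 4 * d → ¬ Retained K (Finset.univ.image x) (x (p j))) :
    potential K x m p σ i + 3 * d ≤ potential K x m p σ (i + 4 * d) := by
  induction d with
  | zero => exact le_rfl
  | succ d ih =>
    have h1 := ih (by omega) fun j hj hj' => h j hj (by omega)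
    have h2 := potential_heavy_four (σ := σ) (i := i + 4 * d) hgap (by omega)
      (h _ (by omega) (by omega))
    have e : i + 4 * (d + 1) = i + 4 * d + 4 := by ring
    rw [e]
    omega

end Steps

/-! ### Average over the orders of arrival -/

section Average

variable {n : ℕ} {K : ℕ} {x : Fin n → UnitInterval} {m : ℕ} {p : ℕ → Fin n}

theorem index_ne (hgap : ∀ i, i + 1 < m → (x (p i)).left + 1 < (x (p (i + 1))).left)
    {i k : ℕ} (hik : i < k) (hk : k < m) : p i ≠ p k := fun he => by
  have h := left_le_left hgap (Nat.succ_le_of_lt hik) hk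
  have h' := hgap i (by omega)
  rw [← he] at h
  linarith

theorem sum_le_orderCount_add {f : Equiv.Perm (Fin n) → ℕ} {P R : Equiv.Perm (Fin n) → Prop}
    (h : ∀ σ, f σ ≤ 1) (h0 : ∀ σ, ¬ P σ → ¬ R σ → f σ = 0) :
    ∑ σ, f σ ≤ orderCount P + orderCount R := by
  rw [orderCount_eq_sum, orderCount_eq_sum, ← Finset.sum_add_distrib]
  refine Finset.sum_le_sum fun σ _ => ?_
  have h1 := h σ
  have h2 := h0 σ
  by_cases hP : P σ
  · rw [if_pos hP]
    omega
  by_cases hR : R σ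
  · rw [if_pos hR]
    omega
  rw [h2 hP hR]
  exact Nat.zero_le _

theorem sum_unseparated_le (hgap : ∀ i, i + 1 < m → (x (p i)).left + 1 < (x (p (i + 1))).left)
    (j : ℕ) : (K + 1) * ∑ σ, unseparated K x m p σ j ≤ 2 * n.factorial := by
  by_cases hj : ¬ Retained K (Finset.univ.image x) (x (p j)) ∧ 1 ≤ j ∧ j + 2 < m
  swap
  · have h0 : ∑ σ, unseparated K x m p σ j = 0 :=
      Finset.sum_eq_zero fun σ _ => if_neg fun h => hj ⟨h.1, h.2.1, h.2.2.1⟩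
    rw [h0]
    exact Nat.zero_le _
  obtain ⟨hh, hj1, hj2⟩ := hj
  obtain ⟨R, hR, hcard, hret⟩ := exists_retained_right hh
  have hex : ∀ I ∈ R, ∃ a, x a = I := fun I hI => by
    obtain ⟨a, -, ha⟩ := Finset.mem_image.mp (hR hI)
    exact ⟨a, ha⟩
  have : Nonempty (Fin n) := ⟨p 0⟩
  choose! idx hidx using hex
  have hinj : Set.InjOn idx R := fun I hI J hJ h => by
    rw [← hidx I hI, h, hidx J hJ]
  set Q := R.image idx
  have hQcard : K ≤ Q.card := by rwa [Finset.card_image_of_injOn hinj]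
  have hQ : ∀ q ∈ Q, Retained K (Finset.univ.image x) (x q) ∧
      ⌊(x q).left⌋ = ⌊(x (p j)).left⌋ ∧ (x (p j)).left < (x q).left := fun q hq => by
    obtain ⟨I, hI, rfl⟩ := Finset.mem_image.mp hq
    rw [hidx I hI]
    exact hret I hI
  have hz : p (j - 1) ∉ Q := fun h => by
    have h1 := hgap (j - 1) (by omega)
    rw [Nat.sub_add_cancel hj1] at h1
    linarith [(hQ _ h).2.2]
  have hw : p (j + 2) ∉ Q := fun h => by
    have := left_lt_add_one_of_floor_eq (hQ _ h).2.1
    linarith [hgap j (by omega), hgap (j + 1) hj2]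
  -- If some `q1` precedes `p (j-1)` and some `q2` precedes `p (j+2)`, the earlier of the two
  -- precedes both and separates. So failure forces one of the two to arrive before all of `Q`.
  have hsum := sum_le_orderCount_add (f := fun σ => unseparated K x m p σ j)
    (P := fun σ => ∀ q ∈ Q, σ.symm (p (j - 1)) < σ.symm q)
    (R := fun σ => ∀ q ∈ Q, σ.symm (p (j + 2)) < σ.symm q)
    (fun σ => by unfold unseparated; split_ifs <;> omega) fun σ h1 h2 => by
    refine if_neg ?_
    push Not at h1 h2
    obtain ⟨q1, hq1, h1⟩ := h1
    obtain ⟨q2, hq2, h2⟩ := h2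
    replace h1 := h1.lt_of_ne fun he => hz (σ.symm.injective he ▸ hq1)
    replace h2 := h2.lt_of_ne fun he => hw (σ.symm.injective he ▸ hq2)
    rintro ⟨-, -, -, hs⟩
    rcases le_total (σ.symm q1) (σ.symm q2) with h | h
    · exact hs ⟨q1, hQ q1 hq1, h1, h.trans_lt h2⟩
    · exact hs ⟨q2, hQ q2 hq2, h.trans_lt h1, h2⟩
  have e1 := card_add_one_mul_orderCount_first_le hz
  have e2 := card_add_one_mul_orderCount_first_le hw
  have e1' := (Nat.mul_le_mul_right _ (Nat.succ_le_succ hQcard)).trans e1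
  have e2' := (Nat.mul_le_mul_right _ (Nat.succ_le_succ hQcard)).trans e2
  calc _ ≤ _ := Nat.mul_le_mul_left (K + 1) hsum
    _ ≤ _ := by rw [mul_add]; simp only [Nat.succ_eq_add_one] at e1' e2'; omega

theorem sum_add_orderCount_le {f g : Equiv.Perm (Fin n) → ℕ} {c : ℕ}
    {P : Equiv.Perm (Fin n) → Prop} (h : ∀ σ, f σ + c ≤ g σ) (hP : ∀ σ, P σ → f σ + c + 1 ≤ g σ) :
    ∑ σ, f σ + n.factorial * c + orderCount P ≤ ∑ σ, g σ := by
  have e : ∑ σ : Equiv.Perm (Fin n), c = n.factorial * c := by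
    rw [Finset.sum_const, Finset.card_univ, Fintype.card_perm, Fintype.card_fin, smul_eq_mul]
  rw [← e, orderCount_eq_sum, ← Finset.sum_add_distrib, ← Finset.sum_add_distrib]
  refine Finset.sum_le_sum fun σ _ => ?_
  split_ifs with hσ
  · exact hP σ hσ
  · exact h σ

/-- The average gain between consecutive retained members is at least 3/4 per step. Blocks of four
heavy steps give 3 each in every order; only the remainder depends on the order. -/
theorem sum_potential_run (hgap : ∀ i, i + 1 < m → (x (p i)).left + 1 < (x (p (i + 1))).left)
    (hK : 0 < K) {k l : ℕ} (hkl : k < l) (hl : l < m)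
    (hk : Retained K (Finset.univ.image x) (x (p k)))
    (hl' : Retained K (Finset.univ.image x) (x (p l)))
    (hbetween : ∀ j, k < j → j < l → ¬ Retained K (Finset.univ.image x) (x (p j))) :
    4 * ∑ σ, potential K x m p σ k + n.factorial * (3 * (l - k)) ≤
      4 * ∑ σ, potential K x m p σ l := by
  -- The remainder is taken in 1, ..., 4 rather than 0, ..., 3, so that the last step always ends at
  -- the retained `p l`.
  obtain ⟨d, hd⟩ : ∃ d, l = k + 4 * d + 1 ∨ l = k + 4 * d + 2 ∨ l = k + 4 * d + 3 ∨
      l = k + 4 * d + 4 := ⟨(l - k - 1) / 4, by omega⟩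
  have hrun : ∀ σ, potential K x m p σ k + 3 * d ≤ potential K x m p σ (k + 4 * d) := fun σ =>
    potential_heavy_run hgap d (by omega) fun j hj hj' => hbetween j hj (by omega)
  rcases hd with rfl | rfl | rfl | rfl
  · have h := sum_add_orderCount_le (f := fun σ => potential K x m p σ k)
      (g := fun σ => potential K x m p σ (k + 4 * d + 1)) (c := 3 * d + 1) (P := fun _ => False)
      (fun σ => by
        have := hrun σ
        have := potential_retained (σ := σ) hgap hl hl'
        omega) fun _ h => h.elim
    have e : k + 4 * d + 1 - k = 4 * d + 1 := by omega
    rw [e]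
    nlinarith
  -- Remainder 2: one interval always, and a second when `p l` precedes `p (l-1)`, with probability
  -- 1/2; 3/2 is exactly what is needed.
  · have h := sum_add_orderCount_le (f := fun σ => potential K x m p σ k)
      (g := fun σ => potential K x m p σ (k + 4 * d + 2)) (c := 3 * d + 1)
      (P := fun σ => σ.symm (p (k + 4 * d + 2)) < σ.symm (p (k + 4 * d + 1)))
      (fun σ => by
        have := hrun σ
        have : potential K x m p σ (k + 4 * d) ≤ potential K x m p σ (k + 4 * d + 1) :=
          potential_mono hgap (Nat.le_succ (k + 4 * d)) (by omega)
        have : potential K x m p σ (k + 4 * d + 1) + 1 ≤ potential K x m p σ (k + 4 * d + 2) :=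
          potential_retained hgap hl hl'
        omega) fun σ hσ => by
        have := hrun σ
        have := potential_retained_right hgap hl hl' hσ
        omega
    have h2 := two_mul_orderCount_lt
      (index_ne hgap (Nat.lt_succ_self (k + 4 * d + 1)) hl).symm
    have e : k + 4 * d + 2 - k = 4 * d + 2 := by omega
    rw [e]
    simp only [Nat.succ_eq_add_one, add_assoc, Nat.reduceAdd] at *
    nlinarith
  -- Remainder 3: two intervals always. With probability 1/4 both retained ends precede their heavy
  -- neighbours; then the blocks of four are shifted by one, with gain 1 before them and 2 after
  -- them. The average 9/4 is again exact.
  · have hrun' : ∀ σ, potential K x m p σ (k + 1) + 3 * d ≤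
        potential K x m p σ (k + 1 + 4 * d) := fun σ =>
      potential_heavy_run hgap d (by omega) fun j hj hj' => hbetween j (by omega) (by omega)
    have hs : k + 1 + 4 * d = k + 4 * d + 1 := by omega
    rw [hs] at hrun'
    have h := sum_add_orderCount_le (f := fun σ => potential K x m p σ k)
      (g := fun σ => potential K x m p σ (k + 4 * d + 3)) (c := 3 * d + 2)
      (P := fun σ => σ.symm (p k) < σ.symm (p (k + 1)) ∧
        σ.symm (p (k + 4 * d + 3)) < σ.symm (p (k + 4 * d + 2)))
      (fun σ => by
        have := hrun σ
        have := potential_heavy_two (σ := σ) (i := k + 4 * d) hgap hK (by omega)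
          (hbetween _ (by omega) (by omega))
        have : potential K x m p σ (k + 4 * d + 2) + 1 ≤ potential K x m p σ (k + 4 * d + 3) :=
          potential_retained hgap hl hl'
        omega) fun σ hσ => by
        have := potential_retained_left hgap (by omega) hk hσ.1
        have := hrun' σ
        have : potential K x m p σ (k + 4 * d + 1) + 2 ≤ potential K x m p σ (k + 4 * d + 3) :=
          potential_retained_right hgap hl hl' hσ.2
        omega
    have h4 := four_mul_orderCount_lt_and_lt (n := n) (a := p k) (b := p (k + 1))
      (c := p (k + 4 * d + 3)) (d := p (k + 4 * d + 2))
      (index_ne hgap (by omega) (by omega)) (index_ne hgap (by omega) (by omega)).symm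
      (index_ne hgap (by omega) (by omega)) (index_ne hgap (by omega) (by omega))
      (index_ne hgap (by omega) (by omega)) (index_ne hgap (by omega) (by omega))
    have e : k + 4 * d + 3 - k = 4 * d + 3 := by omega
    rw [e]
    nlinarith
  -- Remainder 4: a separator of `p (l-2)` and its left neighbour give two, or the credit pays, and
  -- `p l` gives the third.
  · have h := sum_add_orderCount_le (f := fun σ => potential K x m p σ k)
      (g := fun σ => potential K x m p σ (k + 4 * d + 4)) (c := 3 * d + 3) (P := fun _ => False)
      (fun σ => by
        have := hrun σ
        have := potential_heavy_three (σ := σ) (i := k + 4 * d) hgap hl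
          (hbetween _ (by omega) (by omega))
        have : potential K x m p σ (k + 4 * d + 3) + 1 ≤ potential K x m p σ (k + 4 * d + 4) :=
          potential_retained hgap hl hl'
        omega) fun _ h => h.elim
    have e : k + 4 * d + 4 - k = 4 * d + 4 := by omega
    rw [e]
    nlinarith

/-- Induction from each retained member to the previous retained one; the 4 is four times the one
interval available at `p 0`. -/
theorem le_sum_potential (hgap : ∀ i, i + 1 < m → (x (p i)).left + 1 < (x (p (i + 1))).left)
    (hK : 0 < K) (h0 : Retained K (Finset.univ.image x) (x (p 0))) (k : ℕ) (hk : k < m)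
    (hret : Retained K (Finset.univ.image x) (x (p k))) :
    n.factorial * (3 * k + 4) ≤ 4 * ∑ σ, potential K x m p σ k := by
  induction k using Nat.strong_induction_on with
  | _ k ih =>
    rcases Nat.eq_zero_or_pos k with rfl | hpos
    · have h := Finset.sum_le_sum fun (σ : Equiv.Perm (Fin n)) (_ : σ ∈ Finset.univ) =>
        (one_le_bestUpTo (mem_finalIntervals_of_retained (σ := σ) h0)).trans
          (Nat.le_add_right _ (3 * ∑ j ∈ Finset.range (0 + 1), unseparated K x m p σ j))
      rw [Finset.sum_const, Finset.card_univ, Fintype.card_perm, Fintype.card_fin,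
        smul_eq_mul] at h
      change _ ≤ ∑ σ, potential K x m p σ 0 at h
      omega
    · obtain ⟨i, hi, hmax⟩ := Finset.exists_max_image
        ((Finset.range k).filter fun i => Retained K (Finset.univ.image x) (x (p i))) id
        ⟨0, Finset.mem_filter.mpr ⟨Finset.mem_range.mpr hpos, h0⟩⟩
      obtain ⟨hik, hir⟩ := Finset.mem_filter.mp hi
      rw [Finset.mem_range] at hik
      have h1 := ih i hik (hik.trans hk) hir
      have h2 := sum_potential_run hgap hK hik hk hir hret fun j hj hj' hjr => by
        have := hmax j (Finset.mem_filter.mpr ⟨Finset.mem_range.mpr hj', hjr⟩)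
        simp only [id] at this
        omega
      obtain ⟨e, rfl⟩ := Nat.exists_eq_add_of_lt hik
      have e' : i + e + 1 - i = e + 1 := by omega
      rw [e'] at h2
      nlinarith

theorem le_sum_card_result (hgap : ∀ i, i + 1 < m → (x (p i)).left + 1 < (x (p (i + 1))).left)
    (hK : 0 < K) (hm : 0 < m) (h0 : Retained K (Finset.univ.image x) (x (p 0)))
    (hlast : Retained K (Finset.univ.image x) (x (p (m - 1)))) :
    (K + 1) * (n.factorial * (3 * m + 1)) ≤
      (K + 1) * (4 * ∑ σ : Equiv.Perm (Fin n),
        ((algorithm K).result (List.ofFn fun i => x (σ i))).card) + 24 * m * n.factorial := by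
  have h := le_sum_potential hgap hK h0 (m - 1) (by omega) hlast
  have e : 3 * (m - 1) + 4 = 3 * m + 1 := by omega
  rw [e] at h
  have hsplit : ∑ σ, potential K x m p σ (m - 1) ≤
      ∑ σ : Equiv.Perm (Fin n), ((algorithm K).result (List.ofFn fun i => x (σ i))).card +
        3 * ∑ j ∈ Finset.range m, ∑ σ, unseparated K x m p σ j := by
    rw [Finset.sum_comm, Finset.mul_sum, ← Finset.sum_add_distrib]
    refine Finset.sum_le_sum fun σ _ => ?_
    rw [potential, Nat.sub_add_cancel hm]
    exact Nat.add_le_add_right (bestUpTo_le_card_result K _ _) _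
  -- Each of the `m` positions lacks a separator in at most a fraction `2 / (K + 1)` of the orders;
  -- the weight 3 and the factor 4 turn this into the 24 of the statement.
  have hbad : (K + 1) * ∑ j ∈ Finset.range m, ∑ σ, unseparated K x m p σ j ≤
      m * (2 * n.factorial) := by
    rw [Finset.mul_sum]
    refine (Finset.sum_le_card_nsmul _ _ _ fun j _ => sum_unseparated_le hgap j).trans ?_
    rw [Finset.card_range, smul_eq_mul]
  calc _ ≤ _ := Nat.mul_le_mul_left (K + 1) (h.trans (Nat.mul_le_mul_left 4 hsplit))
    _ ≤ _ := by nlinarith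

end Average

/-! ### The optimal solution -/

theorem exists_sorted_indices {n : ℕ} (x : Fin n → UnitInterval) {F : Finset UnitInterval}
    (hF : IsIndependent F) (hmem : ∀ I ∈ F, ∃ a, x a = I) (hpos : 0 < F.card) :
    ∃ p : ℕ → Fin n,
      ∀ i, i + 1 < F.card → (x (p i)).left + 1 < (x (p (i + 1))).left := by
  have hinj : Set.InjOn UnitInterval.left F := fun I _ J _ h => UnitInterval.ext h
  have hcard := Finset.card_image_of_injOn hinj
  have hex : ∀ i : Fin F.card, ∃ a, x a ∈ F ∧
      (x a).left = (F.image UnitInterval.left).orderEmbOfFin hcard i := fun i => by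
    obtain ⟨I, hI, h⟩ := Finset.mem_image.mp
      ((F.image UnitInterval.left).orderEmbOfFin_mem hcard i)
    obtain ⟨a, rfl⟩ := hmem I hI
    exact ⟨a, hI, h⟩
  choose f hf hleft using hex
  refine ⟨fun i => if h : i < F.card then f ⟨i, h⟩ else f ⟨0, hpos⟩, fun i hi => ?_⟩
  have hi' : i < F.card := by omega
  simp only [dif_pos hi, dif_pos hi']
  have hlt : (x (f ⟨i, hi'⟩)).left < (x (f ⟨i + 1, hi⟩)).left := by
    rw [hleft, hleft]
    exact ((F.image UnitInterval.left).orderEmbOfFin hcard).strictMono (Nat.lt_succ_self i)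
  refine UnitInterval.left_add_one_lt_of_inter_eq_empty (hF _ (hf _) _ (hf _) fun h => ?_) hlt.le
  rw [h] at hlt
  exact lt_irrefl _ hlt

/-- Moving the first member to the leftmost interval and the last to the rightmost only widens the
gaps. The former is leftmost in its cell and the latter has nothing to its right, so both are
retained. -/
theorem exists_extremal_indices {n : ℕ} (K : ℕ) (hK : 0 < K) (x : Fin n → UnitInterval)
    {m : ℕ} (hm : 0 < m) {p : ℕ → Fin n}
    (hgap : ∀ i, i + 1 < m → (x (p i)).left + 1 < (x (p (i + 1))).left) :
    ∃ r : ℕ → Fin n, (∀ i, i + 1 < m → (x (r i)).left + 1 < (x (r (i + 1))).left) ∧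
      Retained K (Finset.univ.image x) (x (r 0)) ∧
      Retained K (Finset.univ.image x) (x (r (m - 1))) := by
  have hne : (Finset.univ : Finset (Fin n)).Nonempty := ⟨p 0, Finset.mem_univ _⟩
  obtain ⟨a, -, ha⟩ := Finset.exists_min_image _ (fun i => (x i).left) hne
  obtain ⟨b, -, hb⟩ := Finset.exists_max_image _ (fun i => (x i).left) hne
  have hra : Retained K (Finset.univ.image x) (x a) := Or.inr fun L hL _ => by
    obtain ⟨i, -, rfl⟩ := Finset.mem_image.mp hL
    exact ha i (Finset.mem_univ _)
  have hrb : Retained K (Finset.univ.image x) (x b) := by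
    refine Or.inl ?_
    rw [Finset.filter_false_of_mem, Finset.card_empty]
    · exact hK
    · intro L hL h
      obtain ⟨i, -, rfl⟩ := Finset.mem_image.mp hL
      exact absurd (hb i (Finset.mem_univ _)) (not_le.mpr h.2)
  -- For `m = 1` both conditions hold at 0; the first branch wins, and `a` alone serves as both
  -- ends.
  let r : ℕ → Fin n := fun i => if i = 0 then a else if i = m - 1 then b else p i
  refine ⟨r, fun i hi => ?_, hra, ?_⟩
  · have h1 : (x (r i)).left ≤ (x (p i)).left := by
      by_cases h : i = 0
      · rw [show r i = a from if_pos h]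
        exact ha _ (Finset.mem_univ _)
      · rw [show r i = p i from (if_neg h).trans (if_neg (by omega))]
    have h2 : (x (p (i + 1))).left ≤ (x (r (i + 1))).left := by
      by_cases h : i + 1 = m - 1
      · rw [show r (i + 1) = b from (if_neg i.succ_ne_zero).trans (if_pos h)]
        exact hb _ (Finset.mem_univ _)
      · rw [show r (i + 1) = p (i + 1) from (if_neg i.succ_ne_zero).trans (if_neg h)]
    linarith [hgap i hi]
  · by_cases h : m - 1 = 0
    · rwa [show r (m - 1) = a from if_pos h]
    · rwa [show r (m - 1) = b from (if_neg h).trans (if_pos rfl)]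

theorem mul_le_of_weighted_le {k N c s : ℝ} (hk : 0 < k) (hN : 0 ≤ N)
    (h : k * (N * (3 * c + 1)) ≤ k * (4 * s) + 24 * c * N) : (3 / 4 - 6 / k) * c * N ≤ s := by
  have e : k * ((3 / 4 - 6 / k) * c * N) = k * (3 / 4 * c * N) - 6 * c * N := by
    field_simp
  refine le_of_mul_le_mul_left (e.trans_le ?_) hk
  nlinarith [mul_nonneg hk.le hN]

theorem le_expectedSize {n : ℕ} (K : ℕ) (hK : 0 < K) (x : Fin n → UnitInterval) :
    (3 / 4 - 6 / (K + 1) : ℝ) * optSize (List.ofFn x) ≤ (algorithm K).expectedSize x := by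
  obtain ⟨F, hmem, hF, hcard⟩ := exists_card_eq_optSize (List.ofFn x)
  have hfac : (0 : ℝ) < n.factorial := by exact_mod_cast n.factorial_pos
  rw [← hcard, StreamingAlgorithm.expectedSize, le_div_iff₀ hfac]
  rcases Nat.eq_zero_or_pos F.card with h0 | hpos
  · rw [h0, Nat.cast_zero, mul_zero, zero_mul]
    exact Finset.sum_nonneg fun σ _ => Nat.cast_nonneg _
  obtain ⟨p, hp⟩ := exists_sorted_indices x hF (fun I hI => List.mem_ofFn.mp (hmem I hI)) hpos
  obtain ⟨r, hr, hfirst, hlast⟩ := exists_extremal_indices K hK x hpos hp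
  have h := (Nat.cast_le (α := ℝ)).mpr (le_sum_card_result hr hK hpos hfirst hlast)
  push_cast at h
  exact mul_le_of_weighted_le (by positivity) hfac.le h

end UnitIntervalSelection

theorem theorem1 :
    ∃ A : UnitIntervalSelection.StreamingAlgorithm,
      A.Solves ∧
      (∃ C : ℕ, A.UsesAtMost C) ∧
      ∀ (n : ℕ) (x : Fin n → UnitIntervalSelection.UnitInterval),
        (0.7401 : ℝ) * (UnitIntervalSelection.optSize (List.ofFn x) : ℝ) ≤ A.expectedSize x := by
  -- The ratio obtained is `3/4 - 6/1001`, about 0.744; any `K` with `6 / (K + 1) ≤ 0.0099` would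
  -- do.
  refine ⟨UnitIntervalSelection.algorithm 1000, UnitIntervalSelection.algorithm_solves 1000,
    ⟨_, UnitIntervalSelection.algorithm_usesAtMost 1000⟩, fun n x => ?_⟩
  refine le_trans (mul_le_mul_of_nonneg_right ?_ (Nat.cast_nonneg _))
    (UnitIntervalSelection.le_expectedSize 1000 (by norm_num) x)
  norm_num
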